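/- Let $m\ge 3$ be an integer. For a field $K$, let $\mathcal A_m(K)$ be the set of the hyperplanes of $K^m$ of the following two types: (I) $\{x\in K^m : x_i=x_j\}$ for $1\le i<j\le m$; (II) $\{x\in K^m : x_a+x_b=x_c+x_d\}$ for distinct $a,b,c,d\in\{1,\dots,m\}$ with $a<b$ and $a<c<d$. The mid-hyperplane arrangement is $\mathcal A_m:=\mathcal A_m(\mathbb R)$ and, for a prime $q$, its reduction modulo $q$ is $\mathcal A_{m,q}:=\mathcal A_m(\mathbb F_q)$. For a finite set $\mathcal A$ of linear hyperplanes in a finite-dimensional vector space $V$, let $L(\mathcal A)$ be the set of all intersections of subfamilies of $\mathcal A$ (including $V$, the empty intersection), ordered by reverse inclusion; let $\mu:L(\mathcal A)\to\mathbb Z$ be its Möbius function, given by $\mu(V)=1$ and $\sum_{Y\le X}\mu(Y)=0$ for $X>V$; let $\chi(\mathcal A,t)=\sum_{X\in L(\mathcal A)}\mu(X)\,t^{\dim X}$ be the characteristic polynomial of $\mathcal A$; and let $M(\mathcal A)=V\setminus\bigcup_{H\in\mathcal A}H$. **Theorem.** If $q$ is a prime number with $$q>\begin{cases}2^{m-2}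 & \text{if } m\le 5,\\ 8\cdot 3^{m-5} & \text{if } m\ge 6,\end{cases}$$ then the intersection lattices $L(\mathcal A_m)$ and $L(\mathcal A_{m,q})$ are isomorphic, and $$\chi(\mathcal A_m,q)=|M(\mathcal A_{m,q})|.$$ -/

import Mathlib

namespace MidHyperplane

section General

variable {K V : Type*} [Field K] [AddCommGroup V] [Module K V]

open Classical in
/-- The edges of a finite arrangement `A` of linear hyperplanes in `V`: all intersections of
subfamilies of `A`. The empty subfamily gives `V` itself (`⊤`). The hyperplanes are linear, so
every intersection contains `0` and the condition of being nonempty is automatic. -/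
noncomputable def edges (A : Finset (Submodule K V)) : Finset (Submodule K V) :=
  A.powerset.image fun S => S.inf id

/-- The intersection lattice `L(A)`: the set of edges of `A`, ordered by reverse inclusion. -/
def IntersectionLattice (A : Finset (Submodule K V)) : Type _ :=
  OrderDual {X : Submodule K V // X ∈ edges A}

namespace IntersectionLattice

/-- The edge, as a linear subspace of `V`. -/
def toSubmodule {A : Finset (Submodule K V)} (X : IntersectionLattice A) : Submodule K V :=
  (OrderDual.ofDual X).1

instance (A : Finset (Submodule K V)) : PartialOrder (IntersectionLattice A) :=
  inferInstanceAs (PartialOrder (OrderDual {X : Submodule K V // X ∈ edges A}))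

theorem le_iff {A : Finset (Submodule K V)} (X Y : IntersectionLattice A) :
    X ≤ Y ↔ Y.toSubmodule ≤ X.toSubmodule := Iff.rfl

noncomputable instance (A : Finset (Submodule K V)) : Fintype (IntersectionLattice A) :=
  inferInstanceAs (Fintype (OrderDual {X : Submodule K V // X ∈ edges A}))

theorem top_mem_edges (A : Finset (Submodule K V)) : (⊤ : Submodule K V) ∈ edges A := by
  classical
  exact Finset.mem_image.2 ⟨∅, by simp, by simp⟩

/-- The whole space `V` is the least element of `L(A)`. -/
instance (A : Finset (Submodule K V)) : OrderBot (IntersectionLattice A) where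
  bot := OrderDual.toDual ⟨⊤, top_mem_edges A⟩
  bot_le X := (le_iff _ X).2 le_top

noncomputable instance (A : Finset (Submodule K V)) : DecidableEq (IntersectionLattice A) :=
  Classical.decEq _

open Classical in
noncomputable instance (A : Finset (Submodule K V)) :
    LocallyFiniteOrder (IntersectionLattice A) :=
  Fintype.toLocallyFiniteOrder

/-- The Möbius function `μ(X) = μ(V, X)` of the intersection lattice. -/
noncomputable def moebius {A : Finset (Submodule K V)} (X : IntersectionLattice A) : ℤ :=
  IncidenceAlgebra.mu ℤ (⊥ : IntersectionLattice A) X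

end IntersectionLattice

/-- The characteristic polynomial `χ(A, t) = ∑_{X ∈ L(A)} μ(X) t ^ dim X`. -/
noncomputable def charPoly (A : Finset (Submodule K V)) : Polynomial ℤ :=
  ∑ X : IntersectionLattice A,
    Polynomial.C X.moebius * Polynomial.X ^ Module.finrank K X.toSubmodule

/-- The complement `M(A)`: the points of `V` on none of the hyperplanes of `A`. -/
def complement (A : Finset (Submodule K V)) : Set V :=
  {x | ∀ H ∈ A, x ∉ H}

end General

section Mid

variable (K : Type*) [Field K] {m : ℕ}

/-- The hyperplane `x_i = x_j` in `K ^ m`. -/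
def diagHyperplane (i j : Fin m) : Submodule K (Fin m → K) where
  carrier := {x | x i = x j}
  add_mem' := by
    intro x y hx hy
    simp only [Set.mem_ofPred_eq, Pi.add_apply] at *
    rw [hx, hy]
  zero_mem' := rfl
  smul_mem' := by
    intro c x hx
    simp only [Set.mem_ofPred_eq, Pi.smul_apply] at *
    rw [hx]

/-- The hyperplane `x_a + x_b = x_c + x_d` in `K ^ m`. -/
def midHyperplane (a b c d : Fin m) : Submodule K (Fin m → K) where
  carrier := {x | x a + x b = x c + x d}
  add_mem' := by
    intro x y hx hy
    simp only [Set.mem_ofPred_eq, Pi.add_apply] at *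
    linear_combination hx + hy
  zero_mem' := by simp
  smul_mem' := by
    intro t x hx
    simp only [Set.mem_ofPred_eq, Pi.smul_apply, smul_eq_mul] at *
    linear_combination t * hx

/-- The index set `I₄` of quadruples `(a, b, c, d)` of distinct indices with
`a < b` and `a < c < d`. -/
def I4 (m : ℕ) : Finset (Fin m × Fin m × Fin m × Fin m) :=
  Finset.univ.filter fun (a, b, c, d) => a < b ∧ a < c ∧ c < d ∧ b ≠ c ∧ b ≠ d

open Classical in
/-- The mid-hyperplane arrangement, by its defining equations over a field `K`. For `K = ℝ` this
is `A_m`; for `K = ZMod q` it is the reduction `A_{m,q}` of `A_m` modulo the prime `q`. -/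
noncomputable def midArrangement (m : ℕ) : Finset (Submodule K (Fin m → K)) :=
  ((Finset.univ.filter fun p : Fin m × Fin m => p.1 < p.2).image
      fun p => diagHyperplane K p.1 p.2) ∪
    (I4 m).image fun p => midHyperplane K p.1 p.2.1 p.2.2.1 p.2.2.2

end Mid

end MidHyperplane

namespace MidHyperplane

/-! ### Lattices and characteristic polynomials from dimensions of intersections -/

section Transfer

variable {K V K' V' : Type*} [Field K] [AddCommGroup V] [Module K V] [Field K'] [AddCommGroup V']
  [Module K' V']

/-! Both arrangements have the same integer normal vectors, so it suffices that every subfamily of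
normals has the same rank over ℝ and over 𝔽_q: the dimensions of all intersections then agree, and
they determine the order and the characteristic polynomial (`exists_orderIso_of_finrank_eq`,
`charPoly_eq_of_orderIso`).

Every normal has coordinate sum zero, so with n = m - 1 the last coordinate can be deleted without
changing ranks. The truncated normals span Kⁿ over every field, so an independent subfamily extends
to a basis, and only the n × n determinants matter (`finrank_span_castVec_le`). For such a
determinant N, the Gram matrix of the untruncated rows has determinant (n + 1)N², and Hadamard's
inequality with squared lengths at most 4 gives (n + 1)N² ≤ 4ⁿ (`succ_mul_det_sq_le`). The
hypothesis on q then forces |N| < q, so N vanishes mod q only if N = 0.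

The equality with the point count is the finite field method: Möbius inversion over 𝔽_q
(`charPoly_eval_card`). -/

theorem IntersectionLattice.toSubmodule_injective {A : Finset (Submodule K V)} :
    Function.Injective (toSubmodule : IntersectionLattice A → Submodule K V) :=
  fun _ _ h => Subtype.ext h

/-- The Möbius function of an intersection lattice is invariant under order isomorphisms. -/
theorem IntersectionLattice.moebius_orderIso {A : Finset (Submodule K V)}
    {A' : Finset (Submodule K' V')} (e : IntersectionLattice A ≃o IntersectionLattice A')
    (X : IntersectionLattice A) : (e X).moebius = X.moebius := by
  induction X using WellFoundedLT.induction with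
  | ind X ih =>
    unfold moebius at *
    rw [IncidenceAlgebra.mu_apply, IncidenceAlgebra.mu_apply]
    have hbot : (⊥ = e X) ↔ (⊥ = X) := by
      rw [← e.map_bot, e.injective.eq_iff]
    simp only [hbot]
    congr 2
    refine (Finset.sum_nbij' e e.symm ?_ ?_ ?_ ?_ ?_).symm
    · intro Y hY
      simpa using hY
    · intro Y hY
      simp only [Finset.mem_Ico, bot_le, true_and] at hY ⊢
      simpa using e.symm.lt_iff_lt.2 hY
    · simp
    · simp
    · intro Y hY
      exact (ih Y (Finset.mem_Ico.1 hY).2).symm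

/-- An isomorphism of intersection lattices which preserves dimensions preserves the
characteristic polynomial. -/
theorem charPoly_eq_of_orderIso {A : Finset (Submodule K V)} {A' : Finset (Submodule K' V')}
    (e : IntersectionLattice A ≃o IntersectionLattice A')
    (he : ∀ X, Module.finrank K' (e X).toSubmodule = Module.finrank K X.toSubmodule) :
    charPoly A = charPoly A' := by
  refine Fintype.sum_equiv e.toEquiv _ _ fun X => ?_
  simp [he, IntersectionLattice.moebius_orderIso]

section Index

variable {I : Type*} [Fintype I]

open Classical in
/-- The edge cut out by the hyperplanes with index in `S`, in an arrangement indexed by `I`. -/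
noncomputable def edgeOf (H : I → Submodule K V) (S : Finset I) :
    IntersectionLattice (Finset.univ.image H) :=
  OrderDual.toDual ⟨S.inf H, Finset.mem_image.2 ⟨S.image H, by
    simpa using Finset.image_subset_image (Finset.subset_univ S), by
    simp [Finset.inf_image]⟩⟩

open Classical in
theorem edgeOf_surjective (H : I → Submodule K V) : Function.Surjective (edgeOf H) := by
  rintro ⟨X, hX⟩
  obtain ⟨T, hT, rfl⟩ := Finset.mem_image.1 hX
  obtain ⟨S, -, rfl⟩ := Finset.subset_image_iff.1 (Finset.mem_powerset.1 hT)
  exact ⟨S, IntersectionLattice.toSubmodule_injective (by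
    change S.inf H = (S.image H).inf id
    simp [Finset.inf_image])⟩

theorem toSubmodule_edgeOf (H : I → Submodule K V) (S : Finset I) :
    (edgeOf H S).toSubmodule = S.inf H := rfl

/-- A subspace lies in another exactly when intersecting with the other does not lower its
dimension. Hence the order on edges can be read off from the dimensions attached to index sets. -/
theorem edgeOf_le_iff_finrank [DecidableEq I] [FiniteDimensional K V] (H : I → Submodule K V) (S T : Finset I) :
    edgeOf H S ≤ edgeOf H T ↔
      Module.finrank K ((S ∪ T).inf H : Submodule K V) =
        Module.finrank K (T.inf H : Submodule K V) := by
  rw [IntersectionLattice.le_iff, toSubmodule_edgeOf, toSubmodule_edgeOf, Finset.inf_union]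
  constructor
  · intro h
    rw [inf_eq_right.2 h]
  · intro h
    exact inf_eq_right.1 (Submodule.eq_of_le_of_finrank_eq inf_le_right h)

open Classical in
/-- Two arrangements with the same index set, in which corresponding intersections have the same
dimension, have isomorphic intersection lattices, by an isomorphism preserving dimensions. -/
theorem exists_orderIso_of_finrank_eq [FiniteDimensional K V] [FiniteDimensional K' V']
    (H : I → Submodule K V) (H' : I → Submodule K' V')
    (h : ∀ S : Finset I, Module.finrank K (S.inf H : Submodule K V) =
      Module.finrank K' (S.inf H' : Submodule K' V')) :
    ∃ e : IntersectionLattice (Finset.univ.image H) ≃o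
        IntersectionLattice (Finset.univ.image H'),
      ∀ X, Module.finrank K' (e X).toSubmodule = Module.finrank K X.toSubmodule := by
  have hle : ∀ S T, edgeOf H' S ≤ edgeOf H' T ↔ edgeOf H S ≤ edgeOf H T := by
    intro S T
    rw [edgeOf_le_iff_finrank, edgeOf_le_iff_finrank, h, h]
  -- Different index sets may cut out the same edge; by `hle` they then do so in both arrangements,
  -- so the choice made by `s` is harmless.
  let s := Function.surjInv (edgeOf_surjective H)
  have hs : ∀ X, edgeOf H (s X) = X := Function.surjInv_eq _
  let f : IntersectionLattice (Finset.univ.image H) ↪o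
      IntersectionLattice (Finset.univ.image H') :=
    OrderEmbedding.ofMapLEIff (fun X => edgeOf H' (s X)) fun X Y => by
      rw [hle, hs, hs]
  have hf : Function.Surjective f := by
    intro Y
    obtain ⟨T, rfl⟩ := edgeOf_surjective H' Y
    exact ⟨edgeOf H T, le_antisymm ((hle _ _).2 (hs _).le) ((hle _ _).2 (hs _).ge)⟩
  refine ⟨RelIso.ofSurjective f hf, fun X => ?_⟩
  change Module.finrank K' ((s X).inf H' : Submodule K' V') = _
  rw [← h, ← toSubmodule_edgeOf, hs]

end Index

end Transfer

/-! ### The finite field method -/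

section FiniteField

variable {K V : Type*} [Field K] [AddCommGroup V] [Module K V] [Fintype K] [Finite V]

open Classical in
/-- Over a finite field with `q` elements, `χ(A, q)` counts the points of the complement. -/
theorem charPoly_eval_card (A : Finset (Submodule K V)) (hA : ∀ H ∈ A, H ≠ ⊤) :
    (charPoly A).eval (Fintype.card K : ℤ) = ((complement A).ncard : ℤ) := by
  have := Fintype.ofFinite V
  -- `c v` is the smallest edge containing `v`: the intersection of all the hyperplanes through `v`.
  let c : V → IntersectionLattice A := fun v =>
    OrderDual.toDual ⟨(A.filter (v ∈ ·)).inf id,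
      Finset.mem_image.2 ⟨_, Finset.mem_powerset.2 (Finset.filter_subset _ _), rfl⟩⟩
  have hc : ∀ v X, v ∈ X.toSubmodule ↔ X ≤ c v := by
    rintro v ⟨X, hX⟩
    obtain ⟨S, hS, rfl⟩ := Finset.mem_image.1 hX
    rw [Finset.mem_powerset] at hS
    change v ∈ S.inf id ↔ (A.filter (v ∈ ·)).inf id ≤ S.inf id
    constructor
    · intro hv
      refine Finset.inf_mono fun H hH => Finset.mem_filter.2 ⟨hS hH, ?_⟩
      exact Finset.inf_le (f := id) hH hv
    · intro h
      refine h ?_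
      simp [Submodule.mem_finsetInf]
  have hbot : ∀ v, ⊥ = c v ↔ v ∈ complement A := by
    intro v
    constructor
    · intro h H hH hv
      refine hA H hH (top_le_iff.1 ?_)
      have h1 : (⊤ : Submodule K V) ≤ (A.filter (v ∈ ·)).inf id :=
        (IntersectionLattice.le_iff (c v) ⊥).1 h.ge
      exact h1.trans (Finset.inf_le (f := id) (Finset.mem_filter.2 ⟨hH, hv⟩))
    · intro h
      refine IntersectionLattice.toSubmodule_injective ?_
      change ⊤ = (A.filter (v ∈ ·)).inf id
      rw [Finset.filter_false_of_mem h, Finset.inf_empty]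
  calc (charPoly A).eval (Fintype.card K : ℤ)
      = ∑ X : IntersectionLattice A, X.moebius * ∑ v : V, if X ≤ c v then 1 else 0 := by
        rw [charPoly, Polynomial.eval_finsetSum]
        refine Finset.sum_congr rfl fun X _ => ?_
        simp only [Polynomial.eval_mul, Polynomial.eval_C, Polynomial.eval_pow, Polynomial.eval_X]
        congr 1
        -- The power q ^ dim X is the number of points of X, which by `hc` are the `v` with `X ≤ c
        -- v`.
        rw [Finset.sum_boole, ← Fintype.card_subtype, ← Nat.cast_pow,
          ← Module.card_eq_pow_finrank (K := K) (V := X.toSubmodule)]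
        exact_mod_cast Fintype.card_congr (Equiv.subtypeEquivRight (hc · X))
    _ = ∑ v : V, ∑ X : IntersectionLattice A, if X ≤ c v then X.moebius else 0 := by
        simp_rw [Finset.mul_sum, mul_ite, mul_one, mul_zero]
        exact Finset.sum_comm
    _ = ∑ v : V, if v ∈ complement A then 1 else 0 := by
        refine Finset.sum_congr rfl fun v _ => ?_
        -- The Möbius sum over the interval from `⊥` to `c v` is 1 if `c v = ⊥` and 0 otherwise.
        have := IncidenceAlgebra.sum_Icc_mu_right (𝕜 := ℤ) (⊥ : IntersectionLattice A) (c v)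
        simp only [hbot] at this
        rw [← this, ← Finset.sum_filter]
        refine Finset.sum_congr ?_ fun _ _ => rfl
        ext X
        simp
    _ = _ := by
        rw [Finset.sum_boole, Set.ncard_eq_toFinset_card', ← Set.toFinset_ofPred]
        rfl

end FiniteField

end MidHyperplane

namespace MidHyperplane

/-! ### Ranks of integer vectors over different fields -/

section Rank

/-- The reduction of an integer vector to a field. -/
def castVec (K : Type*) [Field K] {n : Type*} (u : n → ℤ) : n → K := fun k => (u k : K)

variable {I n : Type*} [Fintype n]

theorem linearIndependent_castVec_iff [DecidableEq n] (K : Type*) [Field K] (f : n → n → ℤ) :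
    LinearIndependent K (fun i => castVec K (f i)) ↔ (((Matrix.of f).det : ℤ) : K) ≠ 0 := by
  have h : ((Matrix.of f).map (Int.castRingHom K)).row = fun i => castVec K (f i) := rfl
  rw [← h, Matrix.linearIndependent_rows_iff_isUnit, Matrix.isUnit_iff_isUnit_det,
    isUnit_iff_ne_zero, ← eq_intCast (Int.castRingHom K), RingHom.map_det]
  rfl

/-- A maximal K-independent `T ⊆ S` extends to a basis `B` of Kⁿ taken from the whole family. The
determinant of `B` is nonzero in K, hence in L, so `T` stays independent over L. Extending to `B` is
what makes full-size determinants suffice in place of all minors. Used in both directions, this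
gives equality of ranks. -/
theorem finrank_span_castVec_le [DecidableEq n] (K L : Type*) [Field K] [Field L] (w : I → n → ℤ)
    (hspan : Submodule.span K (Set.range fun i => castVec K (w i)) = ⊤)
    (hdet : ∀ f : n → I, (((Matrix.of fun k => w (f k)).det : ℤ) : K) ≠ 0 →
      (((Matrix.of fun k => w (f k)).det : ℤ) : L) ≠ 0) (S : Set I) :
    Module.finrank K (Submodule.span K ((fun i => castVec K (w i)) '' S)) ≤
      Module.finrank L (Submodule.span L ((fun i => castVec L (w i)) '' S)) := by
  obtain ⟨T, hTS, -, hST, hT⟩ := exists_linearIndepOn_extension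
    (linearIndepOn_empty K fun i => castVec K (w i)) (Set.empty_subset S)
  obtain ⟨B, -, hTB, hspanB, hB⟩ := exists_linearIndepOn_extension hT (Set.subset_univ T)
  let b : Module.Basis B K (n → K) := Module.Basis.mk hB (by
    rw [← hspan, ← Set.image_univ, Submodule.span_le]
    refine hspanB.trans (le_of_eq ?_)
    rw [Set.image_eq_range])
  -- Two bases of the same space have equally many elements, so `B` can be listed as the rows of a
  -- square matrix.
  let e : n ≃ B := (Pi.basisFun K n).indexEquiv b
  have hL : LinearIndependent L fun k => castVec L (w (e k)) :=
    (linearIndependent_castVec_iff L _).2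
      (hdet _ ((linearIndependent_castVec_iff K _).1 (hB.comp e e.injective)))
  have hBL : LinearIndepOn L (fun i => castVec L (w i)) B := by
    have := hL.comp e.symm e.symm.injective
    simp only [Function.comp_def, Equiv.apply_symm_apply] at this
    exact this
  have hTL := hBL.mono hTB
  have : Finite B := Finite.of_equiv n e
  have : Finite T := Finite.Set.subset B hTB
  have := Fintype.ofFinite T
  have h1 : Submodule.span K ((fun i => castVec K (w i)) '' S) =
      Submodule.span K ((fun i => castVec K (w i)) '' T) :=
    le_antisymm (Submodule.span_le.2 hST) (Submodule.span_mono (Set.image_mono hTS))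
  rw [h1, Set.image_eq_range, finrank_span_eq_card hT, ← finrank_span_eq_card hTL,
    ← Set.image_eq_range (fun i => castVec L (w i)) T]
  exact Submodule.finrank_mono (Submodule.span_mono (Set.image_mono hTS))

/-- The dimension of the common kernel of linear forms with integer coefficients. -/
theorem finrank_inf_add_finrank_span {K : Type*} [Field K] (v : I → n → ℤ)
    (H : I → Submodule K (n → K)) (hH : ∀ i x, x ∈ H i ↔ castVec K (v i) ⬝ᵥ x = 0)
    (S : Finset I) :
    Module.finrank K (S.inf H : Submodule K (n → K)) +
      Module.finrank K (Submodule.span K ((fun i => castVec K (v i)) '' S)) =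
      Fintype.card n := by
  let M : Matrix S n K := Matrix.of fun i => castVec K (v i)
  have h1 : S.inf H = LinearMap.ker M.mulVecLin := by
    ext x
    simp only [Submodule.mem_finsetInf, hH, LinearMap.mem_ker, Matrix.mulVecLin_apply,
      funext_iff, Subtype.forall]
    rfl
  have h2 := M.mulVecLin.finrank_range_add_finrank_ker
  have h3 : Module.finrank K (LinearMap.range M.mulVecLin) =
      Module.finrank K (Submodule.span K ((fun i => castVec K (v i)) '' S)) := by
    rw [Set.image_eq_range]
    exact M.rank_eq_finrank_span_row
  rw [h1, ← h3, add_comm, h2, Module.finrank_fintype_fun_eq_card]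

end Rank

/-! ### A Hadamard bound for vectors of coordinate sum zero -/

section Bound

variable {n : Type*} [Fintype n] [DecidableEq n]

/-- A positive semidefinite matrix with diagonal entries at most `c` has determinant at most
`c ^ n`. -/
theorem _root_.Matrix.PosSemidef.det_le_pow {G : Matrix n n ℝ} (hG : G.PosSemidef) {c : ℝ}
    (hc : 0 < c) (hdiag : ∀ i, G i i ≤ c) : G.det ≤ c ^ Fintype.card n := by
  have htr : ∑ i, hG.1.eigenvalues i ≤ c * Fintype.card n := by
    have h1 := hG.1.trace_eq_sum_eigenvalues
    simp only [RCLike.ofReal_real_eq_id, id] at h1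
    rw [← h1, Matrix.trace]
    calc ∑ i, G.diag i ≤ ∑ _i : n, c := Finset.sum_le_sum fun i _ => hdiag i
      _ = _ := by simp [mul_comm]
  -- AM-GM for the eigenvalues, by multiplying the inequalities x ≤ exp(x - 1); the exponents add up
  -- to trace/c - n ≤ 0.
  have h2 : ∏ i, hG.1.eigenvalues i / c ≤ 1 := by
    calc ∏ i, hG.1.eigenvalues i / c ≤ ∏ i, Real.exp (hG.1.eigenvalues i / c - 1) := by
          refine Finset.prod_le_prod
            (fun i _ => div_nonneg (hG.eigenvalues_nonneg i) hc.le) fun i _ => ?_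
          linarith [Real.add_one_le_exp (hG.1.eigenvalues i / c - 1)]
      _ = Real.exp (∑ i, hG.1.eigenvalues i / c - Fintype.card n) := by
          rw [← Real.exp_sum]
          simp
      _ ≤ 1 := by
          rw [Real.exp_le_one_iff, ← Finset.sum_div, sub_nonpos, div_le_iff₀ hc]
          linarith
  rw [Finset.prod_div_distrib, Finset.prod_const, Finset.card_univ, div_le_one (by positivity)] at h2
  rw [hG.1.det_eq_prod_eigenvalues]
  simpa using h2

/-- A Hadamard type bound: let `W` be the square integer matrix obtained from vectors of coordinate
sum zero and squared length at most `c` by deleting the last coordinate. -/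
theorem succ_mul_det_sq_le {n : ℕ} (f : Fin n → Fin (n + 1) → ℤ) (hsum : ∀ k, ∑ j, f k j = 0)
    {c : ℕ} (hc : 0 < c) (hsq : ∀ k, ∑ j, f k j ^ 2 ≤ c) :
    (n + 1 : ℤ) * (Matrix.of fun k j => f k (Fin.castSucc j)).det ^ 2 ≤ (c : ℤ) ^ n := by
  let W : Matrix (Fin n) (Fin n) ℝ := Matrix.of fun k j => (f k (Fin.castSucc j) : ℝ)
  let A : Matrix (Fin n) (Fin (n + 1)) ℝ := Matrix.of fun k j => (f k j : ℝ)
  have hlast : ∀ k, (f k (Fin.last n) : ℝ) = - ∑ j, W k j := by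
    intro k
    have := hsum k
    rw [Fin.sum_univ_castSucc] at this
    have h : (f k (Fin.last n)) = - ∑ j, f k (Fin.castSucc j) := by linarith
    rw [h]
    simp [W]
  -- The last column of `A` is minus the sum of the others, so A = W [I | -𝟏] and A Aᵀ = W (I + 𝟏𝟏ᵀ)
  -- Wᵀ. The middle factor has determinant n + 1.
  have hW : A * A.transpose =
      W * (1 + Matrix.replicateCol Unit (1 : Fin n → ℝ) *
        Matrix.replicateRow Unit (1 : Fin n → ℝ)) * W.transpose := by
    ext k l
    rw [Matrix.mul_add, Matrix.add_mul, ← Matrix.mul_assoc, Matrix.mul_assoc (W * _)]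
    simp only [Matrix.mul_apply, Matrix.add_apply, Matrix.transpose_apply, Fin.sum_univ_castSucc,
      Matrix.replicateCol_apply, Matrix.replicateRow_apply,
      Finset.univ_unique, Finset.sum_singleton, Pi.one_apply, mul_one, one_mul]
    simp only [A, Matrix.of_apply, hlast, W]
    ring
  have hdet : (A * A.transpose).det = (n + 1) * W.det ^ 2 := by
    rw [hW, Matrix.det_mul, Matrix.det_mul, Matrix.det_transpose,
      Matrix.det_one_add_replicateCol_mul_replicateRow]
    simp [dotProduct]
    ring
  have hpsd : (A * A.transpose).PosSemidef := by
    simpa using Matrix.posSemidef_self_mul_conjTranspose A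
  have hle := hpsd.det_le_pow (c := c) (by exact_mod_cast hc) fun k => by
    have : (A * A.transpose) k k = ((∑ j, f k j ^ 2 : ℤ) : ℝ) := by
      simp [Matrix.mul_apply, A, sq]
    rw [this]
    exact_mod_cast hsq k
  have hWdet : W.det = (((Matrix.of fun k j => f k (Fin.castSucc j)).det : ℤ) : ℝ) := by
    rw [← eq_intCast (Int.castRingHom ℝ), RingHom.map_det]
    rfl
  rw [hdet, hWdet, Fintype.card_fin] at hle
  exact_mod_cast hle

end Bound

end MidHyperplane

namespace MidHyperplane

/-! ### The normals of the mid-hyperplane arrangement -/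

section Mid

/-- The index set of the mid-hyperplane arrangement. -/
abbrev MidIndex (m : ℕ) : Type :=
  {p : Fin m × Fin m // p.1 < p.2} ⊕ {p : Fin m × Fin m × Fin m × Fin m // p ∈ I4 m}

/-- The integer normal vectors of the hyperplanes of the mid-hyperplane arrangement. -/
def midNormal {m : ℕ} : MidIndex m → Fin m → ℤ
  | .inl p => Pi.single p.1.1 1 - Pi.single p.1.2 1
  | .inr p => Pi.single p.1.1 1 + Pi.single p.1.2.1 1 - Pi.single p.1.2.2.1 1
      - Pi.single p.1.2.2.2 1

/-- The hyperplanes of the mid-hyperplane arrangement. -/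
def midPlane (K : Type*) [Field K] {m : ℕ} : MidIndex m → Submodule K (Fin m → K)
  | .inl p => diagHyperplane K p.1.1 p.1.2
  | .inr p => midHyperplane K p.1.1 p.1.2.1 p.1.2.2.1 p.1.2.2.2

open Classical in
theorem midArrangement_eq_image (K : Type*) [Field K] (m : ℕ) :
    midArrangement K m = Finset.univ.image (midPlane K (m := m)) := by
  ext H
  simp [midArrangement, midPlane]

theorem castVec_single (K : Type*) [Field K] {m : ℕ} (i : Fin m) :
    castVec K (Pi.single i 1) = Pi.single i 1 := by
  ext j
  simp [castVec, Pi.single_apply]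

theorem castVec_add (K : Type*) [Field K] {n : Type*} (u v : n → ℤ) :
    castVec K (u + v) = castVec K u + castVec K v := by
  ext j
  simp [castVec]

theorem castVec_sub (K : Type*) [Field K] {n : Type*} (u v : n → ℤ) :
    castVec K (u - v) = castVec K u - castVec K v := by
  ext j
  simp [castVec]

theorem mem_midPlane_iff (K : Type*) [Field K] {m : ℕ} (i : MidIndex m) (x : Fin m → K) :
    x ∈ midPlane K i ↔ castVec K (midNormal i) ⬝ᵥ x = 0 := by
  rcases i with p | p
  · simp only [midNormal, castVec_sub, castVec_single, sub_dotProduct, single_dotProduct, one_mul,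
      sub_eq_zero]
    rfl
  · simp only [midNormal, castVec_sub, castVec_add, castVec_single, sub_dotProduct, add_dotProduct,
      single_dotProduct, one_mul, sub_sub, sub_eq_zero]
    rfl

theorem sum_midNormal {m : ℕ} (i : MidIndex m) : ∑ k, midNormal i k = 0 := by
  rcases i with p | p <;> simp [midNormal, Finset.sum_add_distrib]

theorem sum_midNormal_sq_le {m : ℕ} (i : MidIndex m) : ∑ k, midNormal i k ^ 2 ≤ 4 := by
  have h : ∑ k, midNormal i k ^ 2 = midNormal i ⬝ᵥ midNormal i := by
    simp [dotProduct, sq]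
  rw [h]
  rcases i with ⟨⟨a, b⟩, hp⟩ | ⟨⟨a, b, c, d⟩, hp⟩
  · have hab : a ≠ b := ne_of_lt hp
    simp [midNormal, hab, hab.symm]
  · simp only [I4, Finset.mem_filter, Finset.mem_univ, true_and] at hp
    obtain ⟨hab, hac, hcd, hbc, hbd⟩ := hp
    have had := hac.trans hcd
    simp [midNormal, hab.ne, hab.ne', hac.ne, hac.ne', hcd.ne,
      hcd.ne', had.ne, had.ne', hbc, hbc.symm, hbd, hbd.symm]

theorem midPlane_ne_top (K : Type*) [Field K] {m : ℕ} (i : MidIndex m) : midPlane K i ≠ ⊤ := by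
  intro h
  have hx : ∀ x, x ∈ midPlane K i := fun x => h ▸ Submodule.mem_top
  rcases i with ⟨⟨a, b⟩, hp⟩ | ⟨⟨a, b, c, d⟩, hp⟩
  · have h1 : (Pi.single a 1 : Fin m → K) a = (Pi.single a 1 : Fin m → K) b := hx (Pi.single a 1)
    simp [(ne_of_lt hp).symm] at h1
  · simp only [I4, Finset.mem_filter, Finset.mem_univ, true_and] at hp
    obtain ⟨hab, hac, hcd, -, -⟩ := hp
    have h1 : (Pi.single a 1 : Fin m → K) a + (Pi.single a 1 : Fin m → K) b =
      (Pi.single a 1 : Fin m → K) c + (Pi.single a 1 : Fin m → K) d := hx (Pi.single a 1)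
    simp [hab.ne', hac.ne', (hac.trans hcd).ne'] at h1

/-- Delete the last coordinate of the normal vectors. -/
def midNormalTrunc {n : ℕ} (i : MidIndex (n + 1)) (k : Fin n) : ℤ := midNormal i k.castSucc

theorem span_midNormalTrunc (K : Type*) [Field K] (n : ℕ) :
    Submodule.span K (Set.range fun i : MidIndex (n + 1) => castVec K (midNormalTrunc i)) = ⊤ := by
  rw [eq_top_iff, ← (Pi.basisFun K (Fin n)).span_eq, Submodule.span_le]
  rintro _ ⟨k, rfl⟩
  -- The normal of x_k = x_last truncates to the standard basis vector e_k.
  refine Submodule.subset_span ⟨.inl ⟨(k.castSucc, Fin.last n), Fin.castSucc_lt_last k⟩, ?_⟩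
  ext j
  simp [castVec, midNormalTrunc, midNormal, Pi.single_apply, (Fin.castSucc_lt_last j).ne]

/-- Append the coordinate which makes the sum of the coordinates zero. -/
def snocNegSum (K : Type*) [Field K] (n : ℕ) : (Fin n → K) →ₗ[K] (Fin (n + 1) → K) where
  toFun y := Fin.snoc y (-∑ k, y k)
  map_add' y z := by
    ext j
    refine Fin.lastCases ?_ (fun k => ?_) j
    · simp [Finset.sum_add_distrib, add_comm]
    · simp
  map_smul' c y := by
    ext j
    refine Fin.lastCases ?_ (fun k => ?_) j
    · simp [Finset.mul_sum]
    · simp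

theorem snocNegSum_injective (K : Type*) [Field K] (n : ℕ) :
    Function.Injective (snocNegSum K n) := fun y z h => by
  ext k
  simpa [snocNegSum] using congrFun h k.castSucc

theorem snocNegSum_midNormalTrunc (K : Type*) [Field K] {n : ℕ} (i : MidIndex (n + 1)) :
    snocNegSum K n (castVec K (midNormalTrunc i)) = castVec K (midNormal i) := by
  ext j
  refine Fin.lastCases ?_ (fun k => ?_) j
  · have h := sum_midNormal i
    rw [Fin.sum_univ_castSucc, ← eq_neg_iff_add_eq_zero, eq_comm, neg_eq_iff_eq_neg] at h
    simp [snocNegSum, castVec, midNormalTrunc, h]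
  · simp [snocNegSum, castVec, midNormalTrunc]

/-- The deleted coordinate is recovered by the injective map `snocNegSum`, so truncation loses no
rank. It is needed because the full normals lie in the sum-zero hyperplane and cannot span K^(n+1).
-/
theorem finrank_span_midNormal (K : Type*) [Field K] {n : ℕ} (S : Set (MidIndex (n + 1))) :
    Module.finrank K (Submodule.span K ((fun i => castVec K (midNormal i)) '' S)) =
      Module.finrank K (Submodule.span K ((fun i => castVec K (midNormalTrunc i)) '' S)) := by
  have h : Submodule.span K ((fun i => castVec K (midNormal i)) '' S) =
      (Submodule.span K ((fun i => castVec K (midNormalTrunc i)) '' S)).map (snocNegSum K n) := by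
    rw [Submodule.map_span, Set.image_image]
    simp only [snocNegSum_midNormalTrunc]
  rw [h]
  exact (Submodule.equivMapOfInjective _ (snocNegSum_injective K n) _).finrank_eq.symm

theorem natAbs_lt_of_bound {n q : ℕ} {N : ℤ} (hn : 2 ≤ n)
    (hN : (n + 1 : ℤ) * N ^ 2 ≤ 4 ^ n)
    (hq : if n + 1 ≤ 5 then 2 ^ (n + 1 - 2) < q else 8 * 3 ^ (n + 1 - 5) < q) :
    N.natAbs < q := by
  have hN' : (n + 1) * N.natAbs ^ 2 ≤ 4 ^ n := by
    zify
    simpa using hN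
  generalize N.natAbs = a at hN'
  split_ifs at hq with h5
  · have : n ≤ 4 := by omega
    -- For n = 2, 3, 4 the bound gives a² ≤ 16/3, 16, 256/5, so a ≤ 2, 4, 7. The case n = 2 needs
    -- that a is an integer.
    interval_cases n <;> norm_num at hq hN' <;> nlinarith
  · obtain ⟨k, rfl⟩ : ∃ k, n = k + 5 := ⟨n - 5, by omega⟩
    have h1 : k + 5 + 1 - 5 = k + 1 := by omega
    rw [h1] at hq
    refine lt_of_le_of_lt ?_ hq
    refine (Nat.pow_le_pow_iff_left two_ne_zero).1 ?_
    have h4 : 4 ^ k ≤ 9 ^ k := Nat.pow_le_pow_left (by norm_num) k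
    have h9 : (8 * 3 ^ (k + 1)) ^ 2 = 576 * 9 ^ k := by
      rw [mul_pow, ← pow_mul, mul_comm (k + 1), pow_mul, pow_succ]
      norm_num
      ring
    have h4' : 4 ^ (k + 5) = 1024 * 4 ^ k := by ring
    rw [h9]
    rw [h4'] at hN'
    -- Dropping k a² from (k + 6)a² leaves 6a² ≤ 1024 · 4^k ≤ 1024 · 9^k, which is well below 6 ·
    -- 576 · 9^k.
    nlinarith [Nat.zero_le (k * a ^ 2)]

/-- A multiple of q of absolute value less than q is zero. This is where the size of q enters,
through the Hadamard bound with c = 4, the squared length of a type (II) normal. -/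
theorem det_midNormalTrunc_cast_eq_zero_iff {n q : ℕ} [Fact q.Prime] (hn : 2 ≤ n)
    (hq : if n + 1 ≤ 5 then 2 ^ (n + 1 - 2) < q else 8 * 3 ^ (n + 1 - 5) < q)
    (f : Fin n → MidIndex (n + 1)) :
    (((Matrix.of fun k => midNormalTrunc (f k)).det : ℤ) : ZMod q) = 0 ↔
      (Matrix.of fun k => midNormalTrunc (f k)).det = 0 := by
  rw [ZMod.intCast_zmod_eq_zero_iff_dvd]
  refine ⟨fun h => Int.eq_zero_of_dvd_of_natAbs_lt_natAbs h ?_, fun h => h ▸ dvd_zero _⟩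
  rw [Int.natAbs_natCast]
  refine natAbs_lt_of_bound hn ?_ hq
  exact_mod_cast (succ_mul_det_sq_le (fun k => midNormal (f k))
    (fun k => sum_midNormal _) (c := 4) (by norm_num) fun k => sum_midNormal_sq_le _)

theorem finrank_inf_midPlane_eq {n q : ℕ} [Fact q.Prime] (hn : 2 ≤ n)
    (hq : if n + 1 ≤ 5 then 2 ^ (n + 1 - 2) < q else 8 * 3 ^ (n + 1 - 5) < q)
    (S : Finset (MidIndex (n + 1))) :
    Module.finrank ℝ (S.inf (midPlane ℝ) : Submodule ℝ (Fin (n + 1) → ℝ)) =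
      Module.finrank (ZMod q) (S.inf (midPlane (ZMod q)) : Submodule _ (Fin (n + 1) → ZMod q)) := by
  have h1 := finrank_inf_add_finrank_span midNormal (midPlane ℝ) (mem_midPlane_iff ℝ) S
  have h2 := finrank_inf_add_finrank_span midNormal (midPlane (ZMod q))
    (mem_midPlane_iff (ZMod q)) S
  rw [finrank_span_midNormal] at h1 h2
  have h3 : ∀ f : Fin n → MidIndex (n + 1),
      (((Matrix.of fun k => midNormalTrunc (f k)).det : ℤ) : ℝ) ≠ 0 ↔
      (((Matrix.of fun k => midNormalTrunc (f k)).det : ℤ) : ZMod q) ≠ 0 := fun f => by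
    rw [Ne, Ne, det_midNormalTrunc_cast_eq_zero_iff hn hq, Int.cast_eq_zero]
  have h4 := finrank_span_castVec_le ℝ (ZMod q) midNormalTrunc (span_midNormalTrunc ℝ n)
    (fun f => (h3 f).1) (S : Set (MidIndex (n + 1)))
  have h5 := finrank_span_castVec_le (ZMod q) ℝ midNormalTrunc (span_midNormalTrunc _ n)
    (fun f => (h3 f).2) (S : Set (MidIndex (n + 1)))
  omega

theorem exists_orderIso_midArrangement {n q : ℕ} [Fact q.Prime] (hn : 2 ≤ n)
    (hq : if n + 1 ≤ 5 then 2 ^ (n + 1 - 2) < q else 8 * 3 ^ (n + 1 - 5) < q) :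
    ∃ e : IntersectionLattice (midArrangement ℝ (n + 1)) ≃o
        IntersectionLattice (midArrangement (ZMod q) (n + 1)),
      ∀ X, Module.finrank (ZMod q) (e X).toSubmodule = Module.finrank ℝ X.toSubmodule := by
  rw [midArrangement_eq_image, midArrangement_eq_image]
  exact exists_orderIso_of_finrank_eq _ _ (finrank_inf_midPlane_eq hn hq)

theorem ne_top_of_mem_midArrangement (K : Type*) [Field K] {m : ℕ} {H : Submodule K (Fin m → K)}
    (hH : H ∈ midArrangement K m) : H ≠ ⊤ := by
  rw [midArrangement_eq_image] at hH
  obtain ⟨i, -, rfl⟩ := Finset.mem_image.1 hH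
  exact midPlane_ne_top K i

end Mid

end MidHyperplane

theorem theorem2p5 (m q : ℕ) [Fact q.Prime] (hm : 3 ≤ m)
    (hq : if m ≤ 5 then 2 ^ (m - 2) < q else 8 * 3 ^ (m - 5) < q) :
    Nonempty
      (MidHyperplane.IntersectionLattice (MidHyperplane.midArrangement ℝ m) ≃o
        MidHyperplane.IntersectionLattice (MidHyperplane.midArrangement (ZMod q) m)) ∧
    (MidHyperplane.charPoly (MidHyperplane.midArrangement ℝ m)).eval (q : ℤ) =
      ((MidHyperplane.complement (MidHyperplane.midArrangement (ZMod q) m)).ncard : ℤ) := by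
  obtain ⟨n, rfl⟩ : ∃ n, m = n + 1 := ⟨m - 1, by omega⟩
  obtain ⟨e, he⟩ := MidHyperplane.exists_orderIso_midArrangement (by omega) hq
  refine ⟨⟨e⟩, ?_⟩
  have hcount := MidHyperplane.charPoly_eval_card
    (MidHyperplane.midArrangement (ZMod q) (n + 1))
    fun H hH => MidHyperplane.ne_top_of_mem_midArrangement _ hH
  rw [ZMod.card] at hcount
  rw [MidHyperplane.charPoly_eq_of_orderIso e he, hcount]
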